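/- Let $\beta>1$, $L>0$, $\mu\in\mathbb R$, and let $x_0\in\mathbb R^2$ with $\|x_0\|<1$. Let $H(\beta,L)$ be the class of continuous functions $f:\mathbb R^2\to\mathbb R$ supported in the closed unit ball with $\int_{\mathbb R^2}(1+\|\xi\|^2)^{\beta}|\tilde f(\xi)|^2\,d\xi\le L$, where $\tilde f(\xi)=\int_{\mathbb R^2} f(x)e^{-i\xi\cdot x}\,dx$. Let $Z=S^1\times[-1,1]$ with the measure $ds\,d\theta$ (arc length times Lebesgue measure), and for $f\in H(\beta,L)$ let $$T_\mu f(\theta,s)=\int_{x\cdot\theta=s}e^{\mu x\cdot\theta^\perp}f(x)\,dx,\qquad(\theta,s)\in Z,$$ be the exponential Radon transform, where $\theta^\perp$ is $\theta$ rotated counterclockwise by $\pi/2$. For each $n$ one observes $(\theta_i,s_i,Y_i)$, $i=1,\dots,n$, with $$Y_i=T_\mu f(\theta_i,s_i)+\epsilon_i ,$$ where the $(\theta_i,s_i)$ are i.i.d. random points of $Z$, the $\epsilon_i$ are i.i.d. real random variables with law $G$, mean zero and finite positive variance, and the two families are independent. Let $I_0,v_0,C_3>0$ and assume: (B1) for all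 $|v|\le v_0$, the Kullback distance satisfies $\int \ln\frac{dG(u)}{dG(u+v)}\,dG(u)\le I_0v^2$ (in particular, $G$ is absolutely continuous with respect to these translates); (B2) for every $n$ and every measurable $g:Z\to[0,\infty]$, $E\Big[\sum_{i=1}^n g(\theta_i,s_i)\Big]\le C_3\,n\int_Z g(\theta,s)\,ds\,d\theta$. Let $\psi_n=n^{-\frac{\beta-1}{2\beta+1}}$. Then there is a constant $c_0>0$, depending only on $\beta,L,\mu,x_0,I_0,v_0,C_3$, such that $$\liminf_{n\to\infty}\ \inf_{\hat f_n}\ \sup_{f\in H(\beta,L)}\psi_n^{-2}\,E_f\big[(\hat f_n(x_0)-f(x_0))^2\big]\ \ge\ c_0,$$ where the infimum is over all estimators $\hat f_n$, i.e. all functions $\hat f_n:\mathbb R^2\to\mathbb R$ depending on the data $(\theta_i,s_i,Y_i)_{i\le n}$ such that $\hat f_n(x)$ is a measurable function of the data for each $x$, and $E_f$ is the expectation under the joint law of the data when the true function is $f$. -/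

import Mathlib

open MeasureTheory Filter
open scoped ENNReal

noncomputable section

namespace ERT

/-- The Euclidean plane. -/
abbrev Plane : Type := EuclideanSpace ℝ (Fin 2)

/-- The unit circle `S¹` in the plane. -/
abbrev UnitCircle : Type := Metric.sphere (0 : Plane) 1

/-- The observation space `Z = S¹ × [-1, 1]`. -/
abbrev Cyl : Type := UnitCircle × Set.Icc (-1 : ℝ) 1

/-- The measure `ds dθ` on `Z`: arc length on the circle times Lebesgue measure on `[-1, 1]`. -/
def cylMeasure : Measure Cyl :=
  (volume : Measure Plane).toSphere.prod ((volume : Measure ℝ).comap ((↑) : Set.Icc (-1 : ℝ) 1 → ℝ))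

/-- The unit vector `θ^⊥`, obtained by rotating `θ` by a right angle counterclockwise. -/
def perp (θ : Plane) : Plane := !₂[-θ 1, θ 0]

/-- Arc length parametrization `t ↦ s θ + t θ^⊥` of the line `{x : x · θ = s}`. -/
def linePoint (z : Cyl) (t : ℝ) : Plane :=
  (z.2 : ℝ) • (z.1 : Plane) + t • perp z.1

/-- The exponential Radon transform
`T_μ f (θ, s) = ∫_{x · θ = s} exp (μ x · θ^⊥) f(x) dx`. -/
def expRadon (μ : ℝ) (f : Plane → ℝ) (z : Cyl) : ℝ :=
  ∫ t : ℝ, Real.exp (μ * inner ℝ (linePoint z t) (perp z.1)) * f (linePoint z t)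

/-- The Fourier transform `∫ f(x) exp (- i ξ · x) dx`. -/
def fourierTransform (f : Plane → ℝ) (ξ : Plane) : ℂ :=
  ∫ x : Plane, (f x : ℂ) * Complex.exp (-(Complex.I * (inner ℝ ξ x : ℝ)))

/-- The class `H(β, L)`. Functions enter through their values at points, so the members are the
continuous representatives, which exist since `β > 1`. -/
def sobolevClass (β L : ℝ) : Set (Plane → ℝ) :=
  {f | Continuous f ∧ Function.support f ⊆ Metric.closedBall 0 1 ∧
    ∫⁻ ξ : Plane, ENNReal.ofReal ((1 + ‖ξ‖ ^ 2) ^ β * ‖fourierTransform f ξ‖ ^ 2)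
      ≤ ENNReal.ofReal L}

/-- The joint law of one observation `((θ, s), Y)`, `Y = T_μ f (θ, s) + ε`, where `(θ, s)` has law
`ν`, and `ε` has law `G` and is independent of `(θ, s)`. -/
def obsLaw (μ : ℝ) (ν : Measure Cyl) (G : Measure ℝ) (f : Plane → ℝ) : Measure (Cyl × ℝ) :=
  (ν.prod G).map (fun p => (p.1, expRadon μ f p.1 + p.2))

/-- The joint law of `n` independent observations. -/
def sampleLaw (μ : ℝ) (ν : Measure Cyl) (G : Measure ℝ) (n : ℕ) (f : Plane → ℝ) :
    Measure (Fin n → Cyl × ℝ) :=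
  Measure.pi (fun _ => obsLaw μ ν G f)

/-- Estimators from `n` observations: functions on the plane that depend on the data, with
measurable dependence of each value on the data. -/
def Estimator (n : ℕ) : Type :=
  {e : (Fin n → Cyl × ℝ) → Plane → ℝ // ∀ x, Measurable (fun d => e d x)}

/-- The pointwise mean squared error `E_f (f̂ₙ(x₀) - f(x₀))²`. -/
def mse (μ : ℝ) (ν : Measure Cyl) (G : Measure ℝ) (x₀ : Plane) {n : ℕ} (e : Estimator n)
    (f : Plane → ℝ) : ℝ≥0∞ :=
  ∫⁻ d, ENNReal.ofReal ((e.1 d x₀ - f x₀) ^ 2) ∂(sampleLaw μ ν G n f)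

/-- The noise law is centred with finite positive variance. -/
def IsNoiseLaw (G : Measure ℝ) : Prop :=
  IsProbabilityMeasure G ∧ MemLp (fun u : ℝ => u) 2 G ∧ ∫ u, u ∂G = 0 ∧ 0 < ∫ u, u ^ 2 ∂G

/-- Assumption B1: the Kullback distance between `dG(u)` and `dG(u + v)` (the image of `G` under
`u ↦ u - v`) is at most `I₀ v²` whenever `|v| ≤ v₀`. -/
def NoiseAssumption (I₀ v₀ : ℝ) (G : Measure ℝ) : Prop :=
  ∀ v : ℝ, |v| ≤ v₀ →
    InformationTheory.klDiv G (G.map (fun u => u - v)) ≤ ENNReal.ofReal (I₀ * v ^ 2)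

/-- Assumption B2 for i.i.d. design points with common law `ν`:
`E ∑ i, g(θ_i, s_i) ≤ C₃ n ∫_Z g ds dθ` for every sample size and all measurable `g ≥ 0`. -/
def FeasibleDesign (C₃ : ℝ) (ν : Measure Cyl) : Prop :=
  ∀ (n : ℕ) (g : Cyl → ℝ≥0∞), Measurable g →
    ∫⁻ d, ∑ i, g (d i) ∂(Measure.pi (fun _ : Fin n => ν))
      ≤ ENNReal.ofReal C₃ * n * ∫⁻ z, g z ∂cylMeasure

/-- The rate `ψₙ = n^{-(β-1)/(2β+1)}`. -/
def rate (β : ℝ) (n : ℕ) : ℝ := (n : ℝ) ^ (-((β - 1) / (2 * β + 1)))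

/-- The transform of a continuous function is measurable, so that `obsLaw` is a genuine law. -/
theorem measurable_expRadon (μ : ℝ) {f : Plane → ℝ} (hf : Continuous f) :
    Measurable (expRadon μ f) := by
  have hp : Continuous (fun p : Cyl × ℝ => perp p.1.1) := by
    unfold perp
    fun_prop
  have hl : Continuous (fun p : Cyl × ℝ => linePoint p.1 p.2) := by
    unfold linePoint
    fun_prop
  have h : Continuous (fun p : Cyl × ℝ =>
      Real.exp (μ * inner ℝ (linePoint p.1 p.2) (perp p.1.1)) * f (linePoint p.1 p.2)) := by
    fun_prop
  exact (h.stronglyMeasurable.integral_prod_right (ν := volume)).measurable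

end ERT

end

/-! The bound is Le Cam's two-point argument. The signal `0` is compared with a bump `f` at `x₀` of
width `h = n ^ (-1 / (2 β + 1))` and height `A = a h ^ (β - 1)`, so that `f x₀ = a ψₙ`. At this
height the Sobolev energy is at most `a ^ 2` times that of the unit bump
(`lintegral_scaledBump_le`), so a small `a` puts `f` in the class.

On each line meeting the bump the transform is `O(A h)`, and these lines form a set of measure
`O(h)`. By (B1) and (B2), one observation therefore carries divergence `O(A ^ 2 h ^ 3) = O(a ^ 2 /
n)` (`klDiv_obsLaw_le`, `lintegral_sq_expRadon_le`). Divergence is subadditive over products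
(`klDiv_pi_le`), so the whole sample stays below `1 / 4` for small `a`, and no test separates the
two signals. Thresholding an estimator at `f x₀ / 2` is such a test. Under one of the signals it
thus errs by at least `f x₀ / 2` with probability at least `1 / 4`, which gives risk `a ^ 2 ψₙ ^ 2 /
16` (`le_mse_or_le_mse`). -/

/-! ### Kullback-Leibler divergence: testing bound, products, conditional laws. -/

section KullbackLeibler

open ProbabilityTheory InformationTheory

variable {α γ : Type*} [MeasurableSpace α] [MeasurableSpace γ]

/-- The graph of `klFun` lies above its tangent line at `2`. -/
lemma mul_log_two_sub_one_le_klFun {x : ℝ} (hx : 0 ≤ x) : x * Real.log 2 ≤ klFun x + 1 := by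
  rcases hx.eq_or_lt with rfl | hx
  · simp [klFun_zero]
  · have h := Real.add_one_le_exp (Real.log (2 / x))
    rw [Real.exp_log (by positivity), Real.log_div two_ne_zero hx.ne'] at h
    have h' : x * (Real.log 2 - Real.log x + 1) ≤ 2 := by
      calc _ ≤ x * (2 / x) := by gcongr
        _ = 2 := by field_simp
    rw [klFun_apply]
    linarith

/-- An event that is likely under `P` and unlikely under `Q` forces the Kullback-Leibler divergence
to be large. -/
lemma log_two_mul_le_klDiv_add (P Q : Measure α) [IsFiniteMeasure P] [IsFiniteMeasure Q]
    {s : Set α} (hs : MeasurableSet s) :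
    ENNReal.ofReal (Real.log 2) * P s ≤ klDiv P Q + Q s := by
  by_cases hac : P ≪ Q
  swap
  · simp [klDiv_of_not_ac hac]
  rw [klDiv_eq_lintegral_klFun_of_ac hac, ← Measure.setLIntegral_rnDeriv' hac hs,
    ← lintegral_const_mul _ (Measure.measurable_rnDeriv _ _)]
  calc ∫⁻ x in s, ENNReal.ofReal (Real.log 2) * P.rnDeriv Q x ∂Q
      ≤ ∫⁻ x in s, (ENNReal.ofReal (klFun (P.rnDeriv Q x).toReal) + 1) ∂Q := by
        refine lintegral_mono_ae (ae_restrict_of_ae ?_)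
        filter_upwards [P.rnDeriv_ne_top Q] with x hx
        rw [← ENNReal.ofReal_one, ← ENNReal.ofReal_add (klFun_nonneg ENNReal.toReal_nonneg)
          zero_le_one]
        nth_rewrite 1 [← ENNReal.ofReal_toReal hx]
        rw [← ENNReal.ofReal_mul (Real.log_nonneg one_le_two), mul_comm]
        exact ENNReal.ofReal_le_ofReal (mul_log_two_sub_one_le_klFun ENNReal.toReal_nonneg)
    _ = ∫⁻ x in s, ENNReal.ofReal (klFun (P.rnDeriv Q x).toReal) ∂Q + Q s := by
        rw [lintegral_add_right _ measurable_const]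
        simp
    _ ≤ _ := by
        exact add_le_add (setLIntegral_le_lintegral _ _) le_rfl

/-- Two probability measures with divergence at most `1 / 4` cannot be told apart by a test with
both errors below `1 / 4`. -/
lemma quarter_le_measure_compl_or_of_klDiv_le (P Q : Measure α) [IsProbabilityMeasure P]
    [IsProbabilityMeasure Q] (h : klDiv P Q ≤ ENNReal.ofReal (1 / 4)) {s : Set α}
    (hs : MeasurableSet s) :
    ENNReal.ofReal (1 / 4) ≤ P sᶜ ∨ ENNReal.ofReal (1 / 4) ≤ Q s := by
  by_contra! hc
  obtain ⟨h1, h2⟩ := hc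
  have h3 := (log_two_mul_le_klDiv_add P Q hs).trans (add_le_add h h2.le)
  rw [← ofReal_measureReal, ← ENNReal.ofReal_mul (Real.log_nonneg one_le_two),
    ← ENNReal.ofReal_add (by norm_num) (by norm_num),
    ENNReal.ofReal_le_ofReal_iff (by norm_num)] at h3
  rw [← ofReal_measureReal, ENNReal.ofReal_lt_ofReal_iff (by norm_num),
    probReal_compl_eq_one_sub hs] at h1
  -- If both errors are below `1 / 4`, then `log 2 * P s > (3 / 4) log 2 > 1 / 2`, while the right
  -- side is at most `1 / 4 + 1 / 4`.
  nlinarith [Real.log_two_gt_d9]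

lemma klDiv_prod_le (P Q : Measure α) (P' Q' : Measure γ) [IsProbabilityMeasure P]
    [IsProbabilityMeasure Q] [IsProbabilityMeasure P'] [IsProbabilityMeasure Q'] :
    klDiv (P.prod P') (Q.prod Q') ≤ klDiv P Q + klDiv P' Q' := by
  rw [← Measure.compProd_const, ← Measure.compProd_const, klDiv_compProd_eq_add,
    Measure.compProd_const, Measure.compProd_const]
  gcongr
  -- The remaining term compares `P.prod P'` with `P.prod Q'`. After swapping the factors, both laws
  -- have the same kernel over different first marginals, and the common kernel drops out.
  rw [← Measure.prod_swap (μ := P'), ← Measure.prod_swap (μ := Q')]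
  refine (klDiv_map_le _ _ measurable_swap).trans ?_
  rw [← Measure.compProd_const, ← Measure.compProd_const, klDiv_compProd_left]

lemma klDiv_pi_le (P Q : Measure α) [IsProbabilityMeasure P] [IsProbabilityMeasure Q] (n : ℕ) :
    klDiv (Measure.pi fun _ : Fin n => P) (Measure.pi fun _ : Fin n => Q) ≤ n * klDiv P Q := by
  induction n with
  | zero => rw [Measure.pi_of_empty, Measure.pi_of_empty, klDiv_self]; exact zero_le
  | succ n ih =>
    have hP := (measurePreserving_piFinSuccAbove (fun _ : Fin (n + 1) => P) 0).symm
    have hQ := (measurePreserving_piFinSuccAbove (fun _ : Fin (n + 1) => Q) 0).symm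
    rw [← hP.map_eq, ← hQ.map_eq]
    refine (klDiv_map_le _ _ hP.measurable).trans ((klDiv_prod_le _ _ _ _).trans ?_)
    rw [Nat.cast_succ, add_mul, one_mul, add_comm]
    gcongr

/-- The divergence of two joint laws with the same first marginal is at most the average
divergence of the conditional laws. -/
lemma klDiv_compProd_right_le [MeasurableSpace.CountableOrCountablyGenerated α γ] (ρ : Measure α)
    [IsFiniteMeasure ρ] (κ η : Kernel α γ) [IsMarkovKernel κ] [IsMarkovKernel η]
    (hac : ∀ x, κ x ≪ η x) :
    klDiv (ρ ⊗ₘ κ) (ρ ⊗ₘ η) ≤ ∫⁻ x, klDiv (κ x) (η x) ∂ρ := by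
  have hκ : η.withDensity (κ.rnDeriv η) = κ := by
    ext x s hs
    rw [Kernel.withDensity_apply _ (Kernel.measurable_rnDeriv κ η),
      withDensity_congr_ae Kernel.rnDeriv_eq_rnDeriv_measure,
      Measure.withDensity_rnDeriv_eq _ _ (hac x)]
  have hm : Measurable fun p : α × γ => κ.rnDeriv η p.1 p.2 := Kernel.measurable_rnDeriv κ η
  have hd : ρ ⊗ₘ κ = (ρ ⊗ₘ η).withDensity fun p => κ.rnDeriv η p.1 p.2 := by
    have : IsSFiniteKernel (η.withDensity (κ.rnDeriv η)) := by rw [hκ]; infer_instance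
    rw [← Measure.compProd_withDensity hm, hκ]
  have hr : (ρ ⊗ₘ κ).rnDeriv (ρ ⊗ₘ η) =ᵐ[ρ ⊗ₘ η] fun p => κ.rnDeriv η p.1 p.2 := by
    rw [hd]
    exact Measure.rnDeriv_withDensity _ hm
  rw [klDiv_eq_lintegral_klFun_of_ac
    (Measure.AbsolutelyContinuous.compProd_right (ae_of_all _ hac))]
  have he : ∀ᵐ p ∂(ρ ⊗ₘ η), ENNReal.ofReal (klFun ((ρ ⊗ₘ κ).rnDeriv (ρ ⊗ₘ η) p).toReal)
      = ENNReal.ofReal (klFun (κ.rnDeriv η p.1 p.2).toReal) := by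
    filter_upwards [hr] with p hp
    rw [hp]
  rw [lintegral_congr_ae he, Measure.lintegral_compProd (by fun_prop)]
  refine lintegral_mono fun x => ?_
  rw [klDiv_eq_lintegral_klFun_of_ac (hac x)]
  refine (lintegral_congr_ae ?_).le
  filter_upwards [Kernel.rnDeriv_eq_rnDeriv_measure (κ := κ) (η := η) (a := x)] with y hy
  rw [hy]

end KullbackLeibler

/-! ### Scaled bumps and their Sobolev norms. -/

namespace ERT

/-- A smooth bump function on the plane, supported in the unit ball. -/
noncomputable def bump : ContDiffBump (0 : Plane) := ⟨1 / 2, 1, by norm_num, by norm_num⟩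

/-- The bump function of height `A` and width `h` around `x₀`. -/
noncomputable def scaledBump (x₀ : Plane) (A h : ℝ) (x : Plane) : ℝ := A * bump (h⁻¹ • (x - x₀))

lemma continuous_scaledBump (x₀ : Plane) (A h : ℝ) : Continuous (scaledBump x₀ A h) := by
  have := bump.continuous
  unfold scaledBump
  fun_prop

lemma scaledBump_self (x₀ : Plane) (A h : ℝ) : scaledBump x₀ A h x₀ = A := by
  have : bump (0 : Plane) = 1 := bump.one_of_mem_closedBall (by simp [bump])
  simp [scaledBump, this]

lemma abs_scaledBump_le (x₀ : Plane) (A h : ℝ) (x : Plane) : |scaledBump x₀ A h x| ≤ |A| := by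
  rw [scaledBump, abs_mul, abs_of_nonneg bump.nonneg]
  exact mul_le_of_le_one_right (abs_nonneg A) bump.le_one

lemma scaledBump_eq_zero {x₀ x : Plane} {h : ℝ} (hh : 0 < h) (A : ℝ) (hx : h < ‖x - x₀‖) :
    scaledBump x₀ A h x = 0 := by
  have : bump (h⁻¹ • (x - x₀)) = 0 := by
    refine bump.zero_of_le_dist ?_
    rw [dist_zero_right, norm_smul, norm_inv, Real.norm_of_nonneg hh.le]
    change 1 ≤ _
    rw [inv_mul_eq_div, one_le_div hh]
    exact hx.le
  simp [scaledBump, this]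

lemma fourierTransform_scaledBump (x₀ : Plane) (A : ℝ) {h : ℝ} (hh : 0 < h) (ξ : Plane) :
    ‖fourierTransform (scaledBump x₀ A h) ξ‖ ^ 2
      = A ^ 2 * h ^ 4 * ‖fourierTransform bump (h • ξ)‖ ^ 2 := by
  have h1 : fourierTransform (scaledBump x₀ A h) ξ
      = A * Complex.exp (-(Complex.I * (inner ℝ ξ x₀ : ℝ))) * ((h ^ 2 : ℝ) : ℂ)
        * fourierTransform bump (h • ξ) := by
    unfold fourierTransform
    set F : Plane → ℂ := fun y =>
      (bump y : ℂ) * Complex.exp (-(Complex.I * (inner ℝ (h • ξ) y : ℝ))) with hF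
    have h2 : ∀ x, (scaledBump x₀ A h x : ℂ) * Complex.exp (-(Complex.I * (inner ℝ ξ x : ℝ)))
        = A * Complex.exp (-(Complex.I * (inner ℝ ξ x₀ : ℝ))) * F (h⁻¹ • (x - x₀)) := by
      intro x
      have h3 : inner ℝ ξ x = inner ℝ ξ x₀ + inner ℝ (h • ξ) (h⁻¹ • (x - x₀)) := by
        rw [real_inner_smul_left, real_inner_smul_right, inner_sub_right]
        field_simp
        ring
      rw [h3, hF, scaledBump]
      push_cast
      rw [mul_add, neg_add, Complex.exp_add]
      ring
    simp_rw [h2]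
    rw [integral_const_mul, integral_sub_right_eq_self (fun x => F (h⁻¹ • x)),
      Measure.integral_comp_inv_smul_of_nonneg _ _ hh.le, finrank_euclideanSpace_fin,
      Complex.real_smul]
    ring
  have h4 : ‖Complex.exp (-(Complex.I * (inner ℝ ξ x₀ : ℝ)))‖ = 1 := by
    rw [Complex.norm_exp]
    simp
  rw [h1, norm_mul, norm_mul, norm_mul, h4, Complex.norm_real, Complex.norm_real,
    Real.norm_eq_abs, Real.norm_eq_abs, mul_pow, mul_pow, mul_pow, sq_abs, sq_abs]
  ring

/-- The Fourier transform of the bump function decays faster than any power. -/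
lemma fourierTransform_bump_le (k : ℕ) :
    ∃ C : ℝ, ∀ ξ : Plane, (1 + ‖ξ‖) ^ k * ‖fourierTransform bump ξ‖ ≤ C := by
  have hcs : HasCompactSupport fun x : Plane => (bump x : ℂ) :=
    bump.hasCompactSupport.comp_left Complex.ofReal_zero
  have hcd : ContDiff ℝ (⊤ : ℕ∞) fun x : Plane => (bump x : ℂ) :=
    Complex.ofRealCLM.contDiff.comp bump.contDiff
  set K : SchwartzMap Plane ℂ := hcs.toSchwartzMap hcd with hK
  set C := 2 ^ k * (Finset.Iic (k, 0)).sup (fun m => SchwartzMap.seminorm ℝ m.1 m.2)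
    (FourierTransform.fourier K)
  refine ⟨(2 * Real.pi) ^ k * C, fun ξ => ?_⟩
  -- Mathlib's transform has the phase `2 π ⟨x, ξ⟩`, hence the dilation of the frequency by `(2
  -- π)⁻¹` and the factor `(2 π) ^ k` in the bound.
  have h1 : fourierTransform bump ξ = FourierTransform.fourier K ((2 * Real.pi)⁻¹ • ξ) := by
    rw [SchwartzMap.fourier_coe, Real.fourier_eq', fourierTransform]
    refine integral_congr_ae (ae_of_all _ fun x => ?_)
    have h2 : -2 * Real.pi * inner ℝ x ((2 * Real.pi)⁻¹ • ξ) = - inner ℝ ξ x := by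
      rw [real_inner_smul_right, real_inner_comm]
      field_simp
    change (bump x : ℂ) * _ = _ • (bump x : ℂ)
    rw [h2, smul_eq_mul, mul_comm]
    push_cast
    ring_nf
  have h3 := SchwartzMap.one_add_le_sup_seminorm_apply (𝕜 := ℝ) (m := (k, 0)) le_rfl le_rfl
    (FourierTransform.fourier K) ((2 * Real.pi)⁻¹ • ξ)
  rw [norm_iteratedFDeriv_zero, ← h1, norm_smul, norm_inv,
    Real.norm_of_nonneg (by positivity)] at h3
  have h4 : 1 + ‖ξ‖ ≤ (2 * Real.pi) * (1 + (2 * Real.pi)⁻¹ * ‖ξ‖) := by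
    have := Real.pi_gt_three
    rw [mul_add, mul_inv_cancel_left₀ (by positivity)]
    linarith
  calc (1 + ‖ξ‖) ^ k * ‖fourierTransform bump ξ‖
      ≤ ((2 * Real.pi) * (1 + (2 * Real.pi)⁻¹ * ‖ξ‖)) ^ k * ‖fourierTransform bump ξ‖ := by
        gcongr
    _ = (2 * Real.pi) ^ k * ((1 + (2 * Real.pi)⁻¹ * ‖ξ‖) ^ k * ‖fourierTransform bump ξ‖) := by
        rw [mul_pow, mul_assoc]
    _ ≤ _ := by gcongr

/-- The squared Sobolev norm of the bump function. -/
noncomputable def bumpEnergy (β : ℝ) : ℝ≥0∞ :=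
  ∫⁻ ξ : Plane, ENNReal.ofReal ((1 + ‖ξ‖ ^ 2) ^ β * ‖fourierTransform bump ξ‖ ^ 2)

lemma bumpEnergy_lt_top {β : ℝ} (hβ : 0 ≤ β) : bumpEnergy β < ∞ := by
  -- This gives `2 β ≤ 2 k - 3`, which leaves the weight `(1 + ‖ξ‖) ^ (-3)`; it is integrable
  -- because `3` exceeds the dimension `2`.
  obtain ⟨k, hk⟩ := exists_nat_ge (β + 2)
  obtain ⟨C, hC⟩ := fourierTransform_bump_le k
  refine lt_of_le_of_lt (b := ∫⁻ ξ : Plane, ENNReal.ofReal (C ^ 2) *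
    ENNReal.ofReal ((1 + ‖ξ‖) ^ (-(3 : ℝ)))) (lintegral_mono fun ξ => ?_) ?_
  · rw [← ENNReal.ofReal_mul (sq_nonneg C)]
    refine ENNReal.ofReal_le_ofReal ?_
    have h1 : (0 : ℝ) < 1 + ‖ξ‖ := by positivity
    have h2 : (1 + ‖ξ‖ ^ 2) ^ β ≤ (1 + ‖ξ‖) ^ (2 * β) := by
      rw [Real.rpow_mul h1.le]
      refine Real.rpow_le_rpow (by positivity) ?_ hβ
      rw [Real.rpow_two]
      nlinarith [norm_nonneg ξ]
    have h3 : (1 + ‖ξ‖) ^ (2 * β) ≤ (1 + ‖ξ‖) ^ (-(3 : ℝ)) * ((1 + ‖ξ‖) ^ k) ^ 2 := by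
      rw [← pow_mul, ← Real.rpow_natCast, ← Real.rpow_add h1]
      refine Real.rpow_le_rpow_of_exponent_le (by linarith [norm_nonneg ξ]) ?_
      push_cast
      linarith
    calc (1 + ‖ξ‖ ^ 2) ^ β * ‖fourierTransform bump ξ‖ ^ 2
        ≤ (1 + ‖ξ‖) ^ (-(3 : ℝ)) * ((1 + ‖ξ‖) ^ k) ^ 2 * ‖fourierTransform bump ξ‖ ^ 2 := by
          gcongr
          exact h2.trans h3
      _ = ((1 + ‖ξ‖) ^ k * ‖fourierTransform bump ξ‖) ^ 2 * (1 + ‖ξ‖) ^ (-(3 : ℝ)) := by ring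
      _ ≤ C ^ 2 * (1 + ‖ξ‖) ^ (-(3 : ℝ)) := by
          gcongr
          exact hC ξ
  · rw [lintegral_const_mul _ (by fun_prop)]
    refine ENNReal.mul_lt_top ENNReal.ofReal_lt_top (finite_integral_one_add_norm ?_)
    rw [finrank_euclideanSpace_fin]
    norm_num

lemma measurable_fourierTransform_bump : Measurable (fourierTransform bump) := by
  have hb := bump.continuous
  have h : Continuous fun p : Plane × Plane =>
      ((bump p.2 : ℝ) : ℂ) * Complex.exp (-(Complex.I * (inner ℝ p.1 p.2 : ℝ))) := by
    fun_prop
  exact (h.stronglyMeasurable.integral_prod_right (ν := volume)).measurable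

/-- A bump of height `a h ^ (β - 1)` and width `h ≤ 1` has bounded Sobolev norm. -/
lemma lintegral_scaledBump_le {β h : ℝ} (hβ : 0 ≤ β) (hh : 0 < h) (hh1 : h ≤ 1) (x₀ : Plane)
    (a : ℝ) :
    ∫⁻ ξ : Plane, ENNReal.ofReal ((1 + ‖ξ‖ ^ 2) ^ β *
        ‖fourierTransform (scaledBump x₀ (a * h ^ (β - 1)) h) ξ‖ ^ 2)
      ≤ ENNReal.ofReal (a ^ 2) * bumpEnergy β := by
  set F : Plane → ℝ≥0∞ := fun ξ =>
    ENNReal.ofReal ((1 + ‖ξ‖ ^ 2) ^ β * ‖fourierTransform bump ξ‖ ^ 2) with hF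
  have hFm : Measurable F := by
    have := measurable_fourierTransform_bump
    fun_prop
  have hscale : ∫⁻ ξ, F (h • ξ) = ENNReal.ofReal (h ^ 2)⁻¹ * bumpEnergy β := by
    rw [← lintegral_map hFm (measurable_const_smul h), Measure.map_addHaar_smul _ hh.ne',
      lintegral_smul_measure, finrank_euclideanSpace_fin, abs_of_nonneg (by positivity)]
    rfl
  have hpt : ∀ ξ : Plane, ENNReal.ofReal ((1 + ‖ξ‖ ^ 2) ^ β *
      ‖fourierTransform (scaledBump x₀ (a * h ^ (β - 1)) h) ξ‖ ^ 2)
      ≤ ENNReal.ofReal (a ^ 2 * h ^ 2) * F (h • ξ) := by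
    intro ξ
    rw [fourierTransform_scaledBump _ _ hh, hF, ← ENNReal.ofReal_mul (by positivity)]
    refine ENNReal.ofReal_le_ofReal ?_
    -- As `h ≤ 1`, `1 + ‖ξ‖ ^ 2 ≤ h ^ (-2) * (1 + ‖h • ξ‖ ^ 2)`.
    have h1 : (1 + ‖ξ‖ ^ 2) ^ β ≤ h ^ (-(2 * β)) * (1 + ‖h • ξ‖ ^ 2) ^ β := by
      rw [neg_mul_eq_neg_mul, Real.rpow_mul hh.le, ← Real.mul_rpow (by positivity) (by positivity)]
      refine Real.rpow_le_rpow (by positivity) ?_ hβ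
      rw [Real.rpow_neg hh.le, Real.rpow_two, norm_smul, Real.norm_of_nonneg hh.le, mul_pow,
        mul_add, mul_one, inv_mul_cancel_left₀ (by positivity)]
      gcongr
      exact (one_le_inv₀ (by positivity)).2 (pow_le_one₀ hh.le hh1)
    -- The surviving `h ^ 2` cancels the Jacobian `h ^ (-2)` in `hscale`; this fixes the exponent `β
    -- - 1` of the height.
    have h2 : (h ^ (β - 1)) ^ 2 * h ^ 4 * h ^ (-(2 * β)) = h ^ 2 := by
      rw [← Real.rpow_natCast, ← Real.rpow_natCast h 4, ← Real.rpow_natCast h 2,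
        ← Real.rpow_mul hh.le, ← Real.rpow_add hh, ← Real.rpow_add hh]
      congr 1
      push_cast
      ring
    calc (1 + ‖ξ‖ ^ 2) ^ β
          * ((a * h ^ (β - 1)) ^ 2 * h ^ 4 * ‖fourierTransform bump (h • ξ)‖ ^ 2)
        ≤ (h ^ (-(2 * β)) * (1 + ‖h • ξ‖ ^ 2) ^ β)
          * ((a * h ^ (β - 1)) ^ 2 * h ^ 4 * ‖fourierTransform bump (h • ξ)‖ ^ 2) := by gcongr
      _ = a ^ 2 * ((h ^ (β - 1)) ^ 2 * h ^ 4 * h ^ (-(2 * β)))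
          * ((1 + ‖h • ξ‖ ^ 2) ^ β * ‖fourierTransform bump (h • ξ)‖ ^ 2) := by ring
      _ = _ := by rw [h2]
  refine (lintegral_mono hpt).trans ?_
  rw [lintegral_const_mul _ (by fun_prop), hscale, ← mul_assoc,
    ← ENNReal.ofReal_mul (by positivity), mul_assoc, mul_inv_cancel₀ (by positivity), mul_one]

lemma scaledBump_mem_sobolevClass {β L h a : ℝ} (hβ : 0 ≤ β) (hh : 0 < h) (hh1 : h ≤ 1)
    {x₀ : Plane} (hhx : h ≤ 1 - ‖x₀‖)
    (ha : ENNReal.ofReal (a ^ 2) * bumpEnergy β ≤ ENNReal.ofReal L) :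
    scaledBump x₀ (a * h ^ (β - 1)) h ∈ sobolevClass β L := by
  refine ⟨continuous_scaledBump _ _ _, fun x hx => ?_,
    (lintegral_scaledBump_le hβ hh hh1 x₀ a).trans ha⟩
  rw [mem_closedBall_zero_iff]
  by_contra! hc
  refine hx (scaledBump_eq_zero hh _ ?_)
  linarith [norm_sub_norm_le x x₀]

end ERT

/-! ### The exponential Radon transform of a bump. -/

namespace ERT

lemma inner_perp_self (θ : Plane) : inner ℝ θ (perp θ) = 0 := by
  simp [perp, PiLp.inner_apply, Fin.sum_univ_two]
  ring

lemma norm_perp (θ : Plane) : ‖perp θ‖ = ‖θ‖ := by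
  simp [perp, EuclideanSpace.norm_eq, Fin.sum_univ_two, add_comm]

lemma norm_unitCircle (θ : UnitCircle) : ‖(θ : Plane)‖ = 1 := mem_sphere_zero_iff_norm.1 θ.2

lemma inner_linePoint_perp (z : Cyl) (t : ℝ) : inner ℝ (linePoint z t) (perp z.1) = t := by
  rw [linePoint, inner_add_left, real_inner_smul_left, real_inner_smul_left, inner_perp_self,
    real_inner_self_eq_norm_sq, norm_perp, norm_unitCircle]
  ring

lemma inner_linePoint_self (z : Cyl) (t : ℝ) :
    inner ℝ (linePoint z t) (z.1 : Plane) = (z.2 : ℝ) := by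
  rw [linePoint, inner_add_left, real_inner_smul_left, real_inner_smul_left, real_inner_comm _ (perp _),
    inner_perp_self, real_inner_self_eq_norm_sq, norm_unitCircle]
  ring

/-- The lines that meet the ball of radius `h` around `x₀`. -/
def strip (x₀ : Plane) (h : ℝ) : Set Cyl :=
  {z | (z.2 : ℝ) ∈ Set.Icc (inner ℝ x₀ (z.1 : Plane) - h) (inner ℝ x₀ (z.1 : Plane) + h)}

lemma measurableSet_strip (x₀ : Plane) (h : ℝ) : MeasurableSet (strip x₀ h) := by
  have h1 : Continuous fun z : Cyl => inner ℝ x₀ (z.1 : Plane) := by fun_prop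
  have h2 : Continuous fun z : Cyl => (z.2 : ℝ) := by fun_prop
  exact ((isClosed_le (h1.sub continuous_const) h2).inter
    (isClosed_le h2 (h1.add continuous_const))).measurableSet

/-- The measure of the circle, that is `2π`. -/
noncomputable def arcLength : ℝ := (volume : Measure Plane).toSphere.real Set.univ

lemma arcLength_nonneg : 0 ≤ arcLength := measureReal_nonneg

lemma cylMeasure_strip_le (x₀ : Plane) {h : ℝ} (hh : 0 ≤ h) :
    cylMeasure (strip x₀ h) ≤ ENNReal.ofReal (2 * h * arcLength) := by
  have he : MeasurableEmbedding ((↑) : Set.Icc (-1 : ℝ) 1 → ℝ) :=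
    MeasurableEmbedding.subtype_coe measurableSet_Icc
  have : IsFiniteMeasure ((volume : Measure ℝ).comap ((↑) : Set.Icc (-1 : ℝ) 1 → ℝ)) :=
    ⟨by rw [he.comap_apply, Set.image_univ, Subtype.range_coe]; exact measure_Icc_lt_top⟩
  rw [cylMeasure, Measure.prod_apply (measurableSet_strip x₀ h)]
  calc _ ≤ ∫⁻ _ : UnitCircle, ENNReal.ofReal (2 * h) ∂(volume : Measure Plane).toSphere := by
        refine lintegral_mono fun θ => ?_
        rw [he.comap_apply]
        refine (measure_mono (t := Set.Icc (inner ℝ x₀ (θ : Plane) - h)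
          (inner ℝ x₀ (θ : Plane) + h)) ?_).trans ?_
        · rintro _ ⟨s, hs, rfl⟩
          exact hs
        · rw [Real.volume_Icc]
          exact ENNReal.ofReal_le_ofReal (by linarith)
    _ = _ := by
        rw [lintegral_const, arcLength, ENNReal.ofReal_mul (p := 2 * h) (by positivity),
          ofReal_measureReal]

/-- By Cauchy-Schwarz, `|s - x₀ · θ| ≤ ‖x - x₀‖` for every point `x` of the line, so a line outside
the strip misses the ball. -/
lemma expRadon_scaledBump_eq_zero (μ : ℝ) (x₀ : Plane) (A : ℝ) {h : ℝ} (hh : 0 < h) {z : Cyl}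
    (hz : z ∉ strip x₀ h) : expRadon μ (scaledBump x₀ A h) z = 0 := by
  refine integral_eq_zero_of_ae (ae_of_all _ fun t => ?_)
  have h0 : scaledBump x₀ A h (linePoint z t) = 0 := by
    refine scaledBump_eq_zero hh _ ?_
    by_contra! hc
    refine hz ?_
    have h1 := abs_real_inner_le_norm (linePoint z t - x₀) (z.1 : Plane)
    rw [inner_sub_left, inner_linePoint_self, norm_unitCircle, mul_one] at h1
    have h2 := abs_le.1 (h1.trans hc)
    exact ⟨by linarith, by linarith⟩
  simp [h0]

/-- The line parameter of a point in the ball ranges over an interval of length `2 h`. The ball lies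
in the unit ball, so `|t| ≤ 1` there and the weight is at most `exp |μ|`. -/
lemma abs_expRadon_scaledBump_le (μ : ℝ) {x₀ : Plane} (A : ℝ) {h : ℝ} (hh : 0 < h)
    (hhx : h ≤ 1 - ‖x₀‖) (z : Cyl) :
    |expRadon μ (scaledBump x₀ A h) z| ≤ 2 * h * (Real.exp |μ| * |A|) := by
  set c : ℝ := inner ℝ x₀ (perp z.1) with hc
  have hb : ∀ t : ℝ, ‖Real.exp (μ * inner ℝ (linePoint z t) (perp z.1)) *
      scaledBump x₀ A h (linePoint z t)‖ ≤
      (Set.Icc (c - h) (c + h)).indicator (fun _ => Real.exp |μ| * |A|) t := by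
    intro t
    rcases lt_or_ge h ‖linePoint z t - x₀‖ with ht | ht
    · rw [scaledBump_eq_zero hh _ ht, mul_zero, norm_zero]
      exact Set.indicator_nonneg (fun _ _ => by positivity) _
    · have h1 := abs_real_inner_le_norm (linePoint z t - x₀) (perp z.1)
      rw [inner_sub_left, inner_linePoint_perp, norm_perp, norm_unitCircle, mul_one] at h1
      have h2 := abs_le.1 (h1.trans ht)
      have hmem : t ∈ Set.Icc (c - h) (c + h) := ⟨by linarith, by linarith⟩
      rw [Set.indicator_of_mem hmem, norm_mul, inner_linePoint_perp,
        Real.norm_of_nonneg (Real.exp_pos _).le]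
      have h3 := abs_real_inner_le_norm (linePoint z t) (perp z.1)
      rw [inner_linePoint_perp, norm_perp, norm_unitCircle, mul_one] at h3
      have h4 : |t| ≤ 1 := by linarith [norm_sub_norm_le (linePoint z t) x₀]
      gcongr
      · calc μ * t ≤ |μ * t| := le_abs_self _
          _ = |μ| * |t| := abs_mul _ _
          _ ≤ |μ| := mul_le_of_le_one_right (abs_nonneg _) h4
      · exact abs_scaledBump_le _ _ _ _
  have hi : Integrable ((Set.Icc (c - h) (c + h)).indicator fun _ => Real.exp |μ| * |A|) :=
    (integrable_indicator_iff measurableSet_Icc).2 (integrableOn_const (by simp))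
  have h5 := norm_integral_le_of_norm_le hi (ae_of_all _ hb)
  rw [integral_indicator_const _ measurableSet_Icc, Real.volume_real_Icc_of_le (by linarith),
    smul_eq_mul] at h5
  refine h5.trans (le_of_eq ?_)
  ring

lemma lintegral_sq_expRadon_le {C₃ : ℝ} {ν : Measure Cyl} (hν : FeasibleDesign C₃ ν)
    (μ : ℝ) {x₀ : Plane} (A : ℝ) {h I₀ : ℝ} (hI₀ : 0 ≤ I₀) (hC₃ : 0 ≤ C₃) (hh : 0 < h)
    (hhx : h ≤ 1 - ‖x₀‖) [IsProbabilityMeasure ν] :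
    ∫⁻ z, ENNReal.ofReal (I₀ * expRadon μ (scaledBump x₀ A h) z ^ 2) ∂ν
      ≤ ENNReal.ofReal (C₃ * (I₀ * (2 * h * (Real.exp |μ| * |A|)) ^ 2 * (2 * h * arcLength))) := by
  have hm : Measurable fun z => ENNReal.ofReal (I₀ * expRadon μ (scaledBump x₀ A h) z ^ 2) := by
    have := measurable_expRadon μ (continuous_scaledBump x₀ A h)
    fun_prop
  -- For sample size `1`, (B2) bounds the integral against `ν` itself.
  have h1 := hν 1 _ hm
  simp only [Finset.univ_unique, Finset.sum_singleton, Nat.cast_one, mul_one] at h1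
  rw [(measurePreserving_eval (fun _ : Fin 1 => ν) default).lintegral_comp hm] at h1
  refine h1.trans ?_
  have hb := arcLength_nonneg
  rw [ENNReal.ofReal_mul hC₃]
  gcongr
  calc ∫⁻ z, ENNReal.ofReal (I₀ * expRadon μ (scaledBump x₀ A h) z ^ 2) ∂cylMeasure
      ≤ ∫⁻ z, (strip x₀ h).indicator
          (fun _ => ENNReal.ofReal (I₀ * (2 * h * (Real.exp |μ| * |A|)) ^ 2)) z ∂cylMeasure := by
        refine lintegral_mono fun z => ?_
        by_cases hz : z ∈ strip x₀ h
        · rw [Set.indicator_of_mem hz]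
          refine ENNReal.ofReal_le_ofReal ?_
          rw [← sq_abs (expRadon _ _ _)]
          exact mul_le_mul_of_nonneg_left
            (pow_le_pow_left₀ (abs_nonneg _) (abs_expRadon_scaledBump_le μ A hh hhx z) 2) hI₀
        · rw [Set.indicator_of_notMem hz, expRadon_scaledBump_eq_zero μ x₀ A hh hz]
          simp
    _ = ENNReal.ofReal (I₀ * (2 * h * (Real.exp |μ| * |A|)) ^ 2) * cylMeasure (strip x₀ h) :=
        lintegral_indicator_const (measurableSet_strip x₀ h) _
    _ ≤ _ := by
        rw [ENNReal.ofReal_mul (p := I₀ * (2 * h * (Real.exp |μ| * |A|)) ^ 2) (by positivity)]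
        gcongr
        exact cylMeasure_strip_le x₀ hh.le

/-! ### Laws of the observations and the two-point method. -/

open ProbabilityTheory InformationTheory

/-- The conditional law of an observation `Y` given the design point. -/
noncomputable def obsKernel (μ : ℝ) (G : Measure ℝ) [SFinite G] {f : Plane → ℝ}
    (hf : Measurable (expRadon μ f)) : Kernel Cyl ℝ where
  toFun z := G.map fun u => expRadon μ f z + u
  measurable' := by
    refine Measure.measurable_of_measurable_coe _ fun s hs => ?_
    have h1 : Measurable fun p : Cyl × ℝ => expRadon μ f p.1 + p.2 := by fun_prop
    simp_rw [fun z => Measure.map_apply (μ := G) (measurable_const_add (expRadon μ f z)) hs]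
    exact measurable_measure_prodMk_left (h1 hs)

instance (μ : ℝ) (G : Measure ℝ) [IsProbabilityMeasure G] {f : Plane → ℝ}
    (hf : Measurable (expRadon μ f)) : IsMarkovKernel (obsKernel μ G hf) :=
  ⟨fun _ => Measure.isProbabilityMeasure_map (measurable_const_add _).aemeasurable⟩

/-- Disintegrating over the design point lets (B1) be applied to each conditional law. -/
lemma compProd_obsKernel (μ : ℝ) (ν : Measure Cyl) (G : Measure ℝ) [IsProbabilityMeasure ν]
    [IsProbabilityMeasure G] {f : Plane → ℝ} (hf : Measurable (expRadon μ f)) :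
    ν ⊗ₘ obsKernel μ G hf = obsLaw μ ν G f := by
  have hm : Measurable fun p : Cyl × ℝ => (p.1, expRadon μ f p.1 + p.2) := by fun_prop
  ext s hs
  rw [Measure.compProd_apply hs, obsLaw, Measure.map_apply hm hs, Measure.prod_apply (hm hs)]
  refine lintegral_congr fun z => ?_
  exact Measure.map_apply (measurable_const_add _) (measurable_prodMk_left hs)

lemma isProbabilityMeasure_obsLaw (μ : ℝ) (ν : Measure Cyl) (G : Measure ℝ)
    [IsProbabilityMeasure ν] [IsProbabilityMeasure G] {f : Plane → ℝ}
    (hf : Measurable (expRadon μ f)) : IsProbabilityMeasure (obsLaw μ ν G f) := by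
  rw [← compProd_obsKernel μ ν G hf]
  infer_instance

lemma measurable_expRadon_zero (μ : ℝ) : Measurable (expRadon μ 0) :=
  measurable_expRadon μ continuous_zero

lemma obsKernel_zero (μ : ℝ) (G : Measure ℝ) [SFinite G] (z : Cyl) :
    obsKernel μ G (measurable_expRadon_zero μ) z = G := by
  have h : expRadon μ 0 z = 0 := by simp [expRadon]
  change G.map (fun u => expRadon μ 0 z + u) = G
  simp [h]

/-- The divergence between the laws of one observation without and with a small signal. -/
lemma klDiv_obsLaw_le {I₀ v₀ μ : ℝ} {ν : Measure Cyl} {G : Measure ℝ} [IsProbabilityMeasure ν]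
    [IsProbabilityMeasure G] (hG : NoiseAssumption I₀ v₀ G) {f : Plane → ℝ}
    (hf : Measurable (expRadon μ f)) (hv : ∀ z, |expRadon μ f z| ≤ v₀) :
    klDiv (obsLaw μ ν G 0) (obsLaw μ ν G f) ≤ ∫⁻ z, ENNReal.ofReal (I₀ * expRadon μ f z ^ 2) ∂ν := by
  have hle : ∀ z, klDiv (obsKernel μ G (measurable_expRadon_zero μ) z) (obsKernel μ G hf z)
      ≤ ENNReal.ofReal (I₀ * expRadon μ f z ^ 2) := by
    intro z
    -- (B1) translates `G` by `-v`, whereas the signal translates the noise by `+expRadon μ f z`.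
    have h := hG (-expRadon μ f z) (by rw [abs_neg]; exact hv z)
    rw [neg_sq] at h
    rw [obsKernel_zero]
    convert h using 2
    change G.map (fun u => expRadon μ f z + u) = _
    simp only [sub_neg_eq_add, add_comm]
  rw [← compProd_obsKernel μ ν G (measurable_expRadon_zero μ), ← compProd_obsKernel μ ν G hf]
  refine (klDiv_compProd_right_le ν _ _ fun z => ?_).trans (lintegral_mono hle)
  -- Finite divergence already contains the absolute continuity needed.
  exact (klDiv_ne_top_iff.1 ((hle z).trans_lt ENNReal.ofReal_lt_top).ne).1

/-- **Le Cam's two-point method.** If no test separates the laws of the sample under `0` and `f`,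
then every estimator has a large error at `x₀` under `0` or under `f`. -/
lemma le_mse_or_le_mse {μ : ℝ} {ν : Measure Cyl} {G : Measure ℝ} [IsProbabilityMeasure ν]
    [IsProbabilityMeasure G] {f : Plane → ℝ} (hf : Measurable (expRadon μ f)) {n : ℕ}
    (hkl : n * klDiv (obsLaw μ ν G 0) (obsLaw μ ν G f) ≤ ENNReal.ofReal (1 / 4)) (x₀ : Plane)
    (hfx : 0 ≤ f x₀) (e : Estimator n) :
    ENNReal.ofReal (f x₀ ^ 2 / 16) ≤ mse μ ν G x₀ e 0 ∨
      ENNReal.ofReal (f x₀ ^ 2 / 16) ≤ mse μ ν G x₀ e f := by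
  have := isProbabilityMeasure_obsLaw μ ν G hf
  have := isProbabilityMeasure_obsLaw μ ν G (measurable_expRadon_zero μ)
  -- The test decides for `0` on this event. The error is at least `f x₀ / 2` under `0` off the
  -- event and under `f` on it.
  have hs : MeasurableSet {d | e.1 d x₀ < f x₀ / 2} := measurableSet_lt (e.2 x₀) measurable_const
  have key : ∀ (P : Measure (Fin n → Cyl × ℝ)) (s : Set (Fin n → Cyl × ℝ)) (c : ℝ),
      MeasurableSet s → ENNReal.ofReal (1 / 4) ≤ P s →
      (∀ d ∈ s, f x₀ ^ 2 / 4 ≤ (e.1 d x₀ - c) ^ 2) →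
      ENNReal.ofReal (f x₀ ^ 2 / 16) ≤ ∫⁻ d, ENNReal.ofReal ((e.1 d x₀ - c) ^ 2) ∂P := by
    intro P s c hs hP hd
    calc ENNReal.ofReal (f x₀ ^ 2 / 16)
        = ENNReal.ofReal (f x₀ ^ 2 / 4) * ENNReal.ofReal (1 / 4) := by
          rw [← ENNReal.ofReal_mul (by positivity)]
          congr 1
          ring
      _ ≤ ENNReal.ofReal (f x₀ ^ 2 / 4) * P s := by gcongr
      _ = ∫⁻ _ in s, ENNReal.ofReal (f x₀ ^ 2 / 4) ∂P := by rw [setLIntegral_const]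
      _ ≤ ∫⁻ d in s, ENNReal.ofReal ((e.1 d x₀ - c) ^ 2) ∂P :=
          setLIntegral_mono' hs fun d hds => ENNReal.ofReal_le_ofReal (hd d hds)
      _ ≤ _ := setLIntegral_le_lintegral _ _
  refine (quarter_le_measure_compl_or_of_klDiv_le _ _ ((klDiv_pi_le _ _ n).trans hkl) hs).imp
    (fun h => key _ _ _ hs.compl h fun d hd => ?_) (fun h => key _ _ _ hs h fun d hd => ?_)
  · simp only [Set.mem_compl_iff, Set.mem_ofPred_eq, not_lt] at hd
    simp only [Pi.zero_apply, sub_zero]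
    nlinarith
  · simp only [Set.mem_ofPred_eq] at hd
    nlinarith

lemma zero_mem_sobolevClass (β L : ℝ) : 0 ∈ sobolevClass β L :=
  ⟨continuous_zero, by simp, by simp [fourierTransform]⟩

end ERT

/-! ### Choice of the width and the height, and conclusion. -/

open InformationTheory in
/-- Under a bump of height `a h ^ (β - 1)` and width `h = n ^ (-1 / (2 β + 1))` the sample is
indistinguishable from noise. -/
lemma ERT.mul_klDiv_scaledBump_le {β μ I₀ v₀ C₃ a h : ℝ} {n : ℕ} {x₀ : ERT.Plane}
    (hβ : 1 < β) (hI₀ : 0 ≤ I₀) (hC₃ : 0 ≤ C₃) (ha : 0 ≤ a) (hh : 0 < h) (hh1 : h ≤ 1)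
    (hhx : h ≤ 1 - ‖x₀‖) (hhv : 2 * h * (Real.exp |μ| * a) ≤ v₀)
    (hn : n * h ^ (2 * β + 1) = 1)
    (haM : a ^ 2 * (C₃ * I₀ * 8 * Real.exp |μ| ^ 2 * ERT.arcLength) ≤ 1 / 4)
    {ν : Measure ERT.Cyl} {G : Measure ℝ} [IsProbabilityMeasure ν] [IsProbabilityMeasure G]
    (hν : ERT.FeasibleDesign C₃ ν) (hG : ERT.NoiseAssumption I₀ v₀ G) :
    n * klDiv (ERT.obsLaw μ ν G 0) (ERT.obsLaw μ ν G (ERT.scaledBump x₀ (a * h ^ (β - 1)) h))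
      ≤ ENNReal.ofReal (1 / 4) := by
  have hA : 0 ≤ a * h ^ (β - 1) := by positivity
  have hAa : a * h ^ (β - 1) ≤ a :=
    mul_le_of_le_one_right ha (Real.rpow_le_one hh.le hh1 (by linarith))
  have hm := ERT.measurable_expRadon μ (ERT.continuous_scaledBump x₀ (a * h ^ (β - 1)) h)
  have hv : ∀ z, |ERT.expRadon μ (ERT.scaledBump x₀ (a * h ^ (β - 1)) h) z| ≤ v₀ := by
    intro z
    refine (ERT.abs_expRadon_scaledBump_le μ _ hh hhx z).trans (le_trans ?_ hhv)
    rw [abs_of_nonneg hA]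
    gcongr
  have hkl := (ERT.klDiv_obsLaw_le (ν := ν) hG hm hv).trans
    (ERT.lintegral_sq_expRadon_le hν μ _ hI₀ hC₃ hh hhx)
  -- `A ^ 2 h ^ 3` is `a ^ 2 h ^ (2 β + 1) = a ^ 2 / n`, so the factor `n` cancels.
  have hp : h ^ (2 * β + 1) = (h ^ (β - 1)) ^ 2 * h ^ 3 := by
    rw [← Real.rpow_natCast, ← Real.rpow_natCast h 3, ← Real.rpow_mul hh.le, ← Real.rpow_add hh]
    congr 1
    push_cast
    ring
  rw [hp] at hn
  rw [abs_of_nonneg hA] at hkl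
  refine (mul_le_mul_right hkl _).trans ?_
  rw [← ENNReal.ofReal_natCast, ← ENNReal.ofReal_mul (Nat.cast_nonneg n)]
  refine ENNReal.ofReal_le_ofReal (le_trans (le_of_eq ?_) haM)
  calc _ = a ^ 2 * (C₃ * I₀ * 8 * Real.exp |μ| ^ 2 * ERT.arcLength)
        * (n * ((h ^ (β - 1)) ^ 2 * h ^ 3)) := by ring
    _ = _ := by rw [hn, mul_one]

theorem mainTheorem4 (β L μ I₀ v₀ C₃ : ℝ) (hβ : 1 < β) (hL : 0 < L) (hI₀ : 0 < I₀)
    (hv₀ : 0 < v₀) (hC₃ : 0 < C₃) (x₀ : ERT.Plane) (hx₀ : ‖x₀‖ < 1) :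
    ∃ c₀ : ℝ, 0 < c₀ ∧
      ∀ (ν : Measure ERT.Cyl) (G : Measure ℝ), IsProbabilityMeasure ν →
        ERT.FeasibleDesign C₃ ν → ERT.IsNoiseLaw G → ERT.NoiseAssumption I₀ v₀ G →
        ENNReal.ofReal c₀ ≤
          liminf (fun n : ℕ => ⨅ e : ERT.Estimator n, ⨆ f ∈ ERT.sobolevClass β L,
            ENNReal.ofReal (ERT.rate β n ^ (-2 : ℤ)) * ERT.mse μ ν G x₀ e f) atTop := by
  have hβ0 : 0 ≤ β := by linarith
  have hβ1 : 0 < 2 * β + 1 := by linarith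
  set W := (ERT.bumpEnergy β).toReal with hW
  have hW0 : 0 ≤ W := ENNReal.toReal_nonneg
  set M := C₃ * I₀ * 8 * Real.exp |μ| ^ 2 * ERT.arcLength with hM
  have hM0 : 0 ≤ M := by
    have := ERT.arcLength_nonneg
    positivity
  -- The value of `a ^ 2`: the first bound keeps the bump in the class, the second keeps the
  -- divergence below `1 / 4`. The `+ 1` avoids division by zero.
  set q := min (L / (W + 1)) (1 / (4 * (M + 1))) with hq
  have hq0 : 0 < q := lt_min (by positivity) (by positivity)
  set a := √q with ha
  have ha0 : 0 < a := Real.sqrt_pos.2 hq0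
  have ha2 : a ^ 2 = q := Real.sq_sqrt hq0.le
  have haW : ENNReal.ofReal (a ^ 2) * ERT.bumpEnergy β ≤ ENNReal.ofReal L := by
    rw [← ENNReal.ofReal_toReal (ERT.bumpEnergy_lt_top hβ0).ne,
      ← ENNReal.ofReal_mul (sq_nonneg a), ha2, ← hW]
    refine ENNReal.ofReal_le_ofReal ?_
    calc q * W ≤ L / (W + 1) * (W + 1) := by
          gcongr
          · exact min_le_left _ _
          · linarith
      _ = L := div_mul_cancel₀ _ (by positivity)
  have haM : a ^ 2 * M ≤ 1 / 4 := by
    rw [ha2]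
    calc q * M ≤ 1 / (4 * (M + 1)) * (M + 1) := by
          gcongr
          · exact min_le_right _ _
          · linarith
      _ = 1 / 4 := by field_simp
  refine ⟨a ^ 2 / 16, by positivity, fun ν G _ hν hG hGB => ?_⟩
  have := hG.1
  refine le_liminf_of_le (by isBoundedDefault) ?_
  have hlim : Tendsto (fun n : ℕ => (n : ℝ) ^ (-(1 / (2 * β + 1)))) atTop (nhds 0) :=
    (tendsto_rpow_neg_atTop (by positivity)).comp tendsto_natCast_atTop_atTop
  have hv1 : 0 < v₀ / (2 * (Real.exp |μ| * a)) := by positivity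
  -- For large `n`, `h` is below `1` for the Sobolev scaling, below `1 - ‖x₀‖` for the support, and
  -- small enough for the transform to stay in the range `|v| ≤ v₀` of (B1).
  filter_upwards [eventually_gt_atTop 0, hlim.eventually_lt_const one_pos,
    hlim.eventually_lt_const (sub_pos.2 hx₀), hlim.eventually_lt_const hv1]
    with n hn0 hn1 hnx hnv
  have hnpos : (0 : ℝ) < n := Nat.cast_pos.2 hn0
  set h := (n : ℝ) ^ (-(1 / (2 * β + 1))) with hh
  have hh0 : 0 < h := Real.rpow_pos_of_pos hnpos _
  have hrate : h ^ (β - 1) = ERT.rate β n := by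
    rw [hh, ← Real.rpow_mul hnpos.le, ERT.rate]
    congr 1
    ring
  have hnh : n * h ^ (2 * β + 1) = 1 := by
    rw [hh, ← Real.rpow_mul hnpos.le, neg_mul, one_div_mul_cancel hβ1.ne', Real.rpow_neg_one,
      mul_inv_cancel₀ hnpos.ne']
  have hhv : 2 * h * (Real.exp |μ| * a) ≤ v₀ := by
    rw [lt_div_iff₀ (by positivity)] at hnv
    linarith
  set f := ERT.scaledBump x₀ (a * h ^ (β - 1)) h with hf
  have hfx : f x₀ = a * ERT.rate β n := by rw [hf, ERT.scaledBump_self, hrate]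
  have hr0 : 0 < ERT.rate β n := Real.rpow_pos_of_pos hnpos _
  have hconst : ENNReal.ofReal (a ^ 2 / 16)
      = ENNReal.ofReal (ERT.rate β n ^ (-2 : ℤ)) * ENNReal.ofReal (f x₀ ^ 2 / 16) := by
    rw [← ENNReal.ofReal_mul (by positivity), hfx]
    congr 1
    rw [zpow_neg, zpow_ofNat]
    field_simp
  refine le_iInf fun e => ?_
  rcases ERT.le_mse_or_le_mse
    (ERT.measurable_expRadon μ (ERT.continuous_scaledBump x₀ (a * h ^ (β - 1)) h))
    (ERT.mul_klDiv_scaledBump_le hβ hI₀.le hC₃.le ha0.le hh0 hn1.le hnx.le hhv hnh haM hν hGB)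
    x₀ (by rw [← hf, hfx]; positivity) e with hlow | hlow
  · refine le_trans ?_ (le_iSup₂ (0 : ERT.Plane → ℝ) (ERT.zero_mem_sobolevClass β L))
    rw [hconst]
    gcongr
  · refine le_trans ?_ (le_iSup₂ f
      (ERT.scaledBump_mem_sobolevClass hβ0 hh0 hn1.le hnx.le haW))
    rw [hconst]
    gcongr
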